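/- For a positive integer $N$, let $\mathrm{d}U$ denote Haar measure of total mass one on the unitary group $\mathrm{U}(N)$. For $z\in\mathbb{C}$ and $a=(a_1,\dots,a_N)$, $b=(b_1,\dots,b_N)\in\mathbb{C}^N$ put $A=\mathrm{diag}(a_1,\dots,a_N)$, $B=\mathrm{diag}(b_1,\dots,b_N)$ and consider the Brézin–Gross–Witten and Harish-Chandra–Itzykson–Zuber integrals $$I_N^{(1)}(z,a)=\int_{\mathrm{U}(N)} e^{\sqrt z\,N\,\mathrm{Tr}(AU+U^{-1})}\,\mathrm{d}U,\qquad I_N^{(2)}(z,a,b)=\int_{\mathrm{U}(N)} e^{zN\,\mathrm{Tr}(AUBU^{-1})}\,\mathrm{d}U,$$ which are functions of $mN+1$ complex variables, $m=1,2$ respectively (the first does not depend on the choice of the square root). For $I_N=I_N^{(m)}$ let $$I_N = 1+\sum_{d=1}^\infty \frac{z^d}{d!}\,I_N^d$$ be the coupling expansion, i.e. the Maclaurin expansion of $I_N$ in $z$, whose coefficients $I_N^d$ are functions of the remaining $mN$ variables. For $\rho>0$ let $\|f\|_\rho$ denote the supremum of $|f|$ over the closed polydisc of polyradius $(\rho,1,\dots,1)$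 in $\mathbb{C}^{mN+1}$, i.e. over $|z|\le\rho$ and all other variables of modulus at most $1$. Given a real number $t>0$, let $$P_N = 1+\sum_{d=1}^{\lfloor tN^2\rfloor}\frac{z^d}{d!}\,I_N^d,\qquad u(\rho)=\frac{1}{1-\frac{e\rho}{t}},\qquad v(\rho)=t\log\frac{t}{e\rho}.$$ Then for each $m\in\{1,2\}$, every integer $N\ge 1$, every $t>0$ and every $\rho$ with $0<\rho<t/e$, $$\|I_N-P_N\|_\rho < u(\rho)\,e^{-v(\rho)N^2}.$$ -/

import Mathlib

open MeasureTheory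

noncomputable section

namespace StrongCoupling

/-! ### Haar probability measure on `U(N)` -/

instance instMeasurableSpaceUnitaryGroup (N : ℕ) :
    MeasurableSpace (Matrix.unitaryGroup (Fin N) ℂ) := borel _

instance instBorelSpaceUnitaryGroup (N : ℕ) :
    BorelSpace (Matrix.unitaryGroup (Fin N) ℂ) := ⟨rfl⟩

instance instCompactSpaceUnitaryGroup (N : ℕ) :
    CompactSpace (Matrix.unitaryGroup (Fin N) ℂ) := by
  suffices h : IsCompact (Matrix.unitaryGroup (Fin N) ℂ : Set (Matrix (Fin N) (Fin N) ℂ)) from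
    isCompact_iff_compactSpace.mp h
  have hK : IsCompact (Set.pi Set.univ (fun _ : Fin N =>
      Set.pi Set.univ (fun _ : Fin N => Metric.closedBall (0 : ℂ) 1))) :=
    isCompact_univ_pi fun _ => isCompact_univ_pi fun _ => isCompact_closedBall _ _
  have hclosed : IsClosed
      ((Matrix.unitaryGroup (Fin N) ℂ : Set (Matrix (Fin N) (Fin N) ℂ))) := by
    have h : (Matrix.unitaryGroup (Fin N) ℂ : Set (Matrix (Fin N) (Fin N) ℂ))
        = {U | U * star U = 1} := by
      ext U
      exact Matrix.mem_unitaryGroup_iff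
    rw [h]
    exact isClosed_eq (by fun_prop) continuous_const
  refine IsCompact.of_isClosed_subset (s := (Set.pi Set.univ (fun _ : Fin N =>
      Set.pi Set.univ (fun _ : Fin N => Metric.closedBall (0 : ℂ) 1)) :
      Set (Matrix (Fin N) (Fin N) ℂ))) hK hclosed ?_
  intro U hU i _ j _
  rw [mem_closedBall_zero_iff]
  exact entry_norm_bound_of_unitary hU i j

/-- The Haar measure of total mass one on the unitary group `U(N)`. -/
def haarU (N : ℕ) : Measure (Matrix.unitaryGroup (Fin N) ℂ) :=
  Measure.haarMeasure ⊤

instance instIsProbabilityMeasureHaarU (N : ℕ) : IsProbabilityMeasure (haarU N) :=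
  ⟨by
    have h := Measure.haarMeasure_self
      (K₀ := (⊤ : TopologicalSpace.PositiveCompacts (Matrix.unitaryGroup (Fin N) ℂ)))
    simpa [haarU] using h⟩

/-! ### The matrix integrals -/

/-- The Bars-Green / Brézin-Gross-Witten / Wadia integral
`∫ exp (√z N Tr (A U + B U⁻¹)) dU` over `U(N)`, with external fields `A`, `B`. (Its value does not
depend on the choice of the square root, since `U ↦ -U` preserves the Haar measure.) -/
def bgwIntegral (N : ℕ) (z : ℂ) (A B : Matrix (Fin N) (Fin N) ℂ) : ℂ :=
  ∫ U : Matrix.unitaryGroup (Fin N) ℂ,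
    Complex.exp (Complex.sqrt z * N *
      Matrix.trace (A * (U : Matrix (Fin N) (Fin N) ℂ)
        + B * ((U⁻¹ : Matrix.unitaryGroup (Fin N) ℂ) : Matrix (Fin N) (Fin N) ℂ))) ∂(haarU N)

/-- The Harish-Chandra / Itzykson-Zuber integral `∫ exp (z N Tr (A U B U⁻¹)) dU` over `U(N)`. -/
def hcizIntegral (N : ℕ) (z : ℂ) (A B : Matrix (Fin N) (Fin N) ℂ) : ℂ :=
  ∫ U : Matrix.unitaryGroup (Fin N) ℂ,
    Complex.exp (z * N *
      Matrix.trace (A * (U : Matrix (Fin N) (Fin N) ℂ) * B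
        * ((U⁻¹ : Matrix.unitaryGroup (Fin N) ℂ) : Matrix (Fin N) (Fin N) ℂ))) ∂(haarU N)

/-- The BGW integral as a function of the coupling parameter `z` and the eigenvalues
`a₁, …, a_N` of the external field (the second field being the identity matrix). -/
def bgw (N : ℕ) (z : ℂ) (a : Fin N → ℂ) : ℂ :=
  bgwIntegral N z (Matrix.diagonal a) 1

/-- The HCIZ integral as a function of the coupling parameter `z` and the eigenvalues
`a₁, …, a_N` (left summand) and `b₁, …, b_N` (right summand) of the two external fields. -/
def hciz (N : ℕ) (z : ℂ) (x : Fin N ⊕ Fin N → ℂ) : ℂ :=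
  hcizIntegral N z (Matrix.diagonal fun i => x (Sum.inl i)) (Matrix.diagonal fun i => x (Sum.inr i))

/-! ### Coupling expansions and norms

A function of the coupling parameter `z` and of field eigenvalues `x` indexed by `ι`. -/

/-- The coupling coefficient of degree `d`: the coefficient of `z ^ d / d!` in the Maclaurin
expansion in `z`, as a function of the field eigenvalues. -/
def couplingCoeff {ι : Type*} (I : ℂ → (ι → ℂ) → ℂ) (d : ℕ) (x : ι → ℂ) : ℂ :=
  iteratedDeriv d (fun z => I z x) 0

/-- The truncation `P = 1 + ∑_{1 ≤ d ≤ D} z ^ d / d! * I^d` of the coupling expansion of `I` at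
degree `D`. -/
def couplingTruncation {ι : Type*} (I : ℂ → (ι → ℂ) → ℂ) (D : ℕ) (z : ℂ) (x : ι → ℂ) : ℂ :=
  1 + ∑ d ∈ Finset.Icc 1 D, z ^ d / (Nat.factorial d : ℂ) * couplingCoeff I d x

/-- The closed origin-centered polydisc of polyradius `(ρ, 1, …, 1)`. -/
def polydisc (ι : Type*) (ρ : ℝ) : Set (ℂ × (ι → ℂ)) :=
  {p | ‖p.1‖ ≤ ρ ∧ ∀ i, ‖p.2 i‖ ≤ 1}

/-- The uniform norm on the polydisc of polyradius `(ρ, 1, …, 1)`, with value `∞` on functions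
that are unbounded there. -/
def polydiscNorm {ι : Type*} (ρ : ℝ) (f : ℂ → (ι → ℂ) → ℂ) : ENNReal :=
  ⨆ p ∈ polydisc ι ρ, ‖f p.1 p.2‖ₑ

/-- `u(x) = 1 / (1 - e x / t)`. -/
def u (t x : ℝ) : ℝ := 1 / (1 - Real.exp 1 * x / t)

/-- `v(x) = t log (t / (e x))`. -/
def v (t x : ℝ) : ℝ := t * Real.log (t / (Real.exp 1 * x))

end StrongCoupling

end

/-! Everything reduces to a bound `N ^ (2 * d) / d!` on the coefficient of `z ^ d`, uniform over
field eigenvalues in the closed unit polydisc. With `q = e ρ / t` and `d > t N²`, the inequality `d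
^ d ≤ e ^ d d!` gives `(ρ N²) ^ d / d! ≤ q ^ d`. The tail is thus at most the geometric sum `q ^ (⌊t
N²⌋ + 1) / (1 - q)`, strictly below `q ^ (t N²) / (1 - q)`, which is the claimed bound
(`polydiscNorm_sub_couplingTruncation_lt`).

For HCIZ the coefficient bound is immediate from `|Tr (A U B U⁻¹)| ≤ N`. For BGW, invariance under
scalar unitaries leaves only the balanced integrals of `Tr (A U) ^ d * Tr (U⁻¹) ^ d`, and these are
at most `d!` once the moments of `|Tr U| ^ (2 d)` are (`integral_norm_trace_pow_le`).

Such a moment is the trace of the projection averaging over conjugation by `U ⊗ ⋯ ⊗ U`, hence the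
dimension of the commutant. A version of Schur–Weyl duality bounds that dimension: an element of the
commutant is determined by its traces against the `d!` permutation operators
(`eq_zero_of_permTrace_eq_zero`). -/

noncomputable section

namespace StrongCoupling

/-! ### Elementary estimates for the tail of the series. -/

section Tail

lemma pow_div_factorial_le {x q : ℝ} (hx : 0 ≤ x) {d : ℕ} (hd : Real.exp 1 * x ≤ q * d) :
    x ^ d / d.factorial ≤ q ^ d := by
  have h1 : (d : ℝ) ^ d / d.factorial ≤ Real.exp d := Real.pow_div_factorial_le_exp d (by positivity) d
  rcases Nat.eq_zero_or_pos d with rfl | hpos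
  · simp
  have hd0 : (0 : ℝ) < d := by exact_mod_cast hpos
  have h2 : (Real.exp 1 * x) ^ d ≤ (q * d) ^ d := pow_le_pow_left₀ (by positivity) hd d
  rw [mul_pow, mul_pow, ← Real.exp_nat_mul, mul_one] at h2
  rw [div_le_iff₀ (by positivity)] at h1 ⊢
  have hq : 0 ≤ q := by
    by_contra hq
    have := mul_neg_of_neg_of_pos (not_le.1 hq) hd0
    have : 0 ≤ Real.exp 1 * x := by positivity
    linarith
  have h3 : x ^ d * Real.exp d ≤ q ^ d * d.factorial * Real.exp d := by
    calc x ^ d * Real.exp d ≤ q ^ d * d ^ d := by linarith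
      _ ≤ q ^ d * (Real.exp d * d.factorial) := by gcongr
      _ = _ := by ring
  exact le_of_mul_le_mul_right h3 (Real.exp_pos _)

/-- Since `exp (-v n²) = q ^ (t n²)` with `0 < q < 1`, the strictness is that of `t n² < ⌊t n²⌋ +
1`. -/
lemma tail_bound_lt {t ρ : ℝ} (ht : 0 < t) (hρ : 0 < ρ) (hρt : ρ < t / Real.exp 1) (n : ℝ) :
    (Real.exp 1 * ρ / t) ^ (⌊t * n ^ 2⌋₊ + 1) * (1 - Real.exp 1 * ρ / t)⁻¹
      < u t ρ * Real.exp (-v t ρ * n ^ 2) := by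
  have he := Real.exp_pos 1
  have hq0 : 0 < Real.exp 1 * ρ / t := by positivity
  have hq1 : Real.exp 1 * ρ / t < 1 := by
    rw [lt_div_iff₀ he] at hρt
    rw [div_lt_one ht]; linarith
  have hexp : Real.exp (-v t ρ * n ^ 2) = (Real.exp 1 * ρ / t) ^ (t * n ^ 2) := by
    rw [Real.rpow_def_of_pos hq0, v, ← inv_div t, Real.log_inv]
    ring_nf
  rw [hexp, u, one_div, mul_comm, ← Real.rpow_natCast]
  have : 0 < (1 - Real.exp 1 * ρ / t)⁻¹ := inv_pos.2 (by linarith)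
  gcongr 1
  refine Real.rpow_lt_rpow_of_exponent_gt hq0 hq1 ?_
  push_cast
  exact Nat.lt_floor_add_one _

end Tail

/-! ### From coefficient bounds to the truncation error. -/

section PowerSeries

lemma iteratedDeriv_zero_of_hasSum {f : ℂ → ℂ} {c : ℕ → ℂ}
    (h : ∀ z, HasSum (fun n => c n * z ^ n) (f z)) (d : ℕ) :
    iteratedDeriv d f 0 = d.factorial * c d := by
  have hp : HasFPowerSeriesAt f (FormalMultilinearSeries.ofScalars ℂ c) 0 := by
    rw [hasFPowerSeriesAt_iff]
    refine Filter.Eventually.of_forall fun z => ?_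
    simpa [FormalMultilinearSeries.coeff_ofScalars, mul_comm] using h z
  have h2 := hp.eq_formalMultilinearSeries (hp.analyticAt.hasFPowerSeriesAt)
  have h3 := congrArg (fun p => FormalMultilinearSeries.coeff p d) h2
  simp only [FormalMultilinearSeries.coeff_ofScalars] at h3
  have h0 : (d.factorial : ℂ) ≠ 0 := by exact_mod_cast d.factorial_ne_zero
  rw [h3]
  field_simp

lemma polydiscNorm_sub_couplingTruncation_lt {ι : Type*} (I : ℂ → (ι → ℂ) → ℂ)
    (c : ℕ → (ι → ℂ) → ℂ) (N : ℕ)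
    (hsum : ∀ x z, HasSum (fun d => c d x * z ^ d) (I z x))
    (hzero : ∀ x, c 0 x = 1)
    (hbound : ∀ d x, (∀ i, ‖x i‖ ≤ 1) → ‖c d x‖ ≤ (N : ℝ) ^ (2 * d) / d.factorial)
    {t ρ : ℝ} (ht : 0 < t) (hρ : 0 < ρ) (hρt : ρ < t / Real.exp 1) :
    polydiscNorm ρ (fun z x => I z x - couplingTruncation I ⌊t * (N : ℝ) ^ 2⌋₊ z x)
      < ENNReal.ofReal (u t ρ * Real.exp (-v t ρ * (N : ℝ) ^ 2)) := by
  have he := Real.exp_pos 1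
  set D := ⌊t * (N : ℝ) ^ 2⌋₊ with hD
  set q := Real.exp 1 * ρ / t with hq
  have hq0 : 0 < q := by positivity
  have hq1 : q < 1 := by
    rw [lt_div_iff₀ he] at hρt
    rw [hq, div_lt_one ht]; linarith
  have hlt := tail_bound_lt ht hρ hρt (N : ℝ)
  rw [← hD, ← hq] at hlt
  have hnn : 0 ≤ q ^ (D + 1) * (1 - q)⁻¹ :=
    mul_nonneg (by positivity) (inv_nonneg.2 (by linarith))
  -- The supremum need not be attained: a non-strict pointwise bound by the geometric tail suffices,
  -- since that number is already strictly smaller than the target.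
  refine lt_of_le_of_lt (iSup₂_le fun p hp => ?_)
    ((ENNReal.ofReal_lt_ofReal_iff (lt_of_le_of_lt hnn hlt)).2 hlt)
  obtain ⟨z, x⟩ := p
  obtain ⟨hz, hx⟩ := hp
  simp only at hz hx ⊢
  have htrunc : couplingTruncation I D z x = ∑ d ∈ Finset.range (D + 1), c d x * z ^ d := by
    rw [Finset.sum_range_succ', couplingTruncation, hzero, pow_zero, mul_one, add_comm]
    congr 1
    rw [Finset.range_eq_Ico, Finset.sum_Ico_add' (fun d => c d x * z ^ d) 0 D 1]
    refine Finset.sum_congr (by ext; simp) fun d _ => ?_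
    rw [couplingCoeff, iteratedDeriv_zero_of_hasSum (hsum x)]
    have : (d.factorial : ℂ) ≠ 0 := by exact_mod_cast d.factorial_ne_zero
    field_simp
  have htail : HasSum (fun d => c (d + (D + 1)) x * z ^ (d + (D + 1)))
      (I z x - couplingTruncation I D z x) := by
    rw [htrunc]
    exact (hasSum_nat_add_iff' (D + 1)).2 (hsum x z)
  have hgeom : HasSum (fun d => q ^ (D + 1) * q ^ d) (q ^ (D + 1) * (1 - q)⁻¹) :=
    (hasSum_geometric_of_lt_one hq0.le hq1).mul_left _
  rw [← ofReal_norm]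
  refine ENNReal.ofReal_le_ofReal ?_
  rw [← htail.tsum_eq]
  refine tsum_of_norm_bounded hgeom fun d => ?_
  rw [← pow_add, add_comm (D + 1) d]
  set k := d + (D + 1) with hk
  have hkD : t * (N : ℝ) ^ 2 ≤ k := by
    have h1 := (Nat.lt_floor_add_one (t * (N : ℝ) ^ 2)).le
    rw [← hD] at h1
    have h2 : ((D + 1 : ℕ) : ℝ) ≤ k := by exact_mod_cast (by omega : D + 1 ≤ k)
    push_cast at h2
    linarith
  calc ‖c k x * z ^ k‖ ≤ (N : ℝ) ^ (2 * k) / k.factorial * ρ ^ k := by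
        rw [norm_mul, norm_pow]
        gcongr
        exact hbound k x hx
    _ = (ρ * N ^ 2) ^ k / k.factorial := by rw [mul_pow, ← pow_mul]; ring
    _ ≤ q ^ k := by
        refine pow_div_factorial_le (by positivity) ?_
        calc Real.exp 1 * (ρ * N ^ 2) = q * (t * (N : ℝ) ^ 2) := by rw [hq]; field_simp
          _ ≤ q * k := by gcongr

end PowerSeries

/-! ### Tensor powers: from commuting with unitaries to commuting with all matrices. -/

section TensorPower

variable {N d : ℕ}

/-- The matrix of `G ⊗ ⋯ ⊗ G` (`d` factors) in the basis of pure tensors of basis vectors. -/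
def tensorPow (d : ℕ) (G : Matrix (Fin N) (Fin N) ℂ) :
    Matrix (Fin d → Fin N) (Fin d → Fin N) ℂ :=
  Matrix.of fun I J => ∏ k, G (I k) (J k)

@[simp]
lemma tensorPow_apply (G : Matrix (Fin N) (Fin N) ℂ) (I J : Fin d → Fin N) :
    tensorPow d G I J = ∏ k, G (I k) (J k) := rfl

lemma tensorPow_mul (G H : Matrix (Fin N) (Fin N) ℂ) :
    tensorPow d (G * H) = tensorPow d G * tensorPow d H := by
  ext I J
  simp only [tensorPow_apply, Matrix.mul_apply, Finset.prod_univ_sum, Fintype.piFinset_univ,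
    Finset.prod_mul_distrib]

lemma tensorPow_one : tensorPow d (1 : Matrix (Fin N) (Fin N) ℂ) = 1 := by
  ext I J
  simp only [tensorPow_apply, Matrix.one_apply, Finset.prod_ite_zero, Finset.prod_const_one,
    funext_iff, Finset.mem_univ, true_imp_iff]

lemma tensorPow_star (G : Matrix (Fin N) (Fin N) ℂ) :
    tensorPow d (star G) = star (tensorPow d G) := by
  ext I J
  simp [Matrix.star_apply]

lemma trace_tensorPow (G : Matrix (Fin N) (Fin N) ℂ) :
    Matrix.trace (tensorPow d G) = Matrix.trace G ^ d := by
  simp [Matrix.trace, Fintype.sum_pow]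

@[fun_prop]
lemma continuous_tensorPow : Continuous (tensorPow (N := N) d) := by
  unfold tensorPow
  fun_prop

lemma tensorPow_diagonal (D : Fin N → ℂ) :
    tensorPow d (Matrix.diagonal D) = Matrix.diagonal fun I => ∏ k, D (I k) := by
  ext I J
  rw [tensorPow_apply]
  by_cases h : I = J
  · subst h; simp
  · rw [Matrix.diagonal_apply_ne _ h]
    obtain ⟨k, hk⟩ := Function.ne_iff.1 h
    exact Finset.prod_eq_zero (Finset.mem_univ k) (Matrix.diagonal_apply_ne _ hk)

/-- The matrices commuting with `U ⊗ ⋯ ⊗ U` for every unitary `U`. -/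
def unitaryCommutant (N d : ℕ) : Submodule ℂ (Matrix (Fin d → Fin N) (Fin d → Fin N) ℂ) where
  carrier := {X | ∀ U ∈ Matrix.unitaryGroup (Fin N) ℂ, X * tensorPow d U = tensorPow d U * X}
  add_mem' hX hY U hU := by rw [add_mul, mul_add, hX U hU, hY U hU]
  zero_mem' U _ := by simp
  smul_mem' c X hX U hU := by rw [Matrix.smul_mul, Matrix.mul_smul, hX U hU]

lemma diagonal_mem_unitaryGroup {D : Fin N → ℂ} (hD : ∀ i, ‖D i‖ = 1) :
    Matrix.diagonal D ∈ Matrix.unitaryGroup (Fin N) ℂ := by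
  rw [Matrix.mem_unitaryGroup_iff, Matrix.star_eq_conjTranspose, Matrix.diagonal_conjTranspose,
    Matrix.diagonal_mul_diagonal, ← Matrix.diagonal_one]
  congr 1
  ext i
  simp [Complex.mul_conj, Complex.normSq_eq_norm_sq, hD]

/-- Irrationality of `π` gives `e ^ i` infinite order, so this one unimodular number separates all
exponents, both for torus weights and for unbalanced trace powers. -/
lemma exp_I_pow_injective : Function.Injective fun n : ℕ => Complex.exp Complex.I ^ n := by
  intro m n h
  simp only [← Complex.exp_nat_mul] at h
  obtain ⟨k, hk⟩ := Complex.exp_eq_exp_iff_exists_int.1 h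
  have h1 : ((m : ℝ) : ℂ) = ((n + k * (2 * Real.pi) : ℝ) : ℂ) := by
    push_cast
    apply mul_right_cancel₀ Complex.I_ne_zero
    rw [hk]; ring
  have h2 : (m : ℝ) = n + k * (2 * Real.pi) := by exact_mod_cast h1
  by_cases hk0 : k = 0
  · simpa [hk0] using h2
  · exfalso
    refine irrational_pi.ne_rat ((((m : ℤ) - n) / (2 * k) : ℚ)) ?_
    have : (k : ℝ) ≠ 0 := by exact_mod_cast hk0
    push_cast
    field_simp
    linarith

/-- Commuting with the diagonal unitary that has `e ^ i` in a single slot forces `I` and `J` to take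
that value equally often wherever `X I J ≠ 0`. -/
lemma prod_comp_eq_of_mem_unitaryCommutant {X : Matrix (Fin d → Fin N) (Fin d → Fin N) ℂ}
    (hX : X ∈ unitaryCommutant N d) {I J : Fin d → Fin N} (hIJ : X I J ≠ 0) (D : Fin N → ℂ) :
    ∏ k, D (I k) = ∏ k, D (J k) := by
  have key : ∀ i, (Finset.univ.filter fun k => I k = i).card
      = (Finset.univ.filter fun k => J k = i).card := by
    intro i
    set D' : Fin N → ℂ := fun j => if j = i then Complex.exp Complex.I else 1 with hD'
    have hmem : Matrix.diagonal D' ∈ Matrix.unitaryGroup (Fin N) ℂ := by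
      refine diagonal_mem_unitaryGroup fun j => ?_
      simp only [hD']
      split_ifs
      · simpa using Complex.norm_exp_ofReal_mul_I 1
      · simp
    have h := congrFun (congrFun (hX _ hmem) I) J
    rw [tensorPow_diagonal, Matrix.mul_diagonal, Matrix.diagonal_mul, mul_comm] at h
    have h2 := mul_right_cancel₀ hIJ h
    simp only [hD', Finset.prod_ite, Finset.prod_const, one_pow, mul_one] at h2
    exact (exp_I_pow_injective h2).symm
  rw [← Finset.prod_fiberwise' Finset.univ I D, ← Finset.prod_fiberwise' Finset.univ J D]
  exact Finset.prod_congr rfl fun i _ => by rw [Finset.prod_const, Finset.prod_const, key i]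

lemma mul_tensorPow_diagonal_comm {X : Matrix (Fin d → Fin N) (Fin d → Fin N) ℂ}
    (hX : X ∈ unitaryCommutant N d) (D : Fin N → ℂ) :
    X * tensorPow d (Matrix.diagonal D) = tensorPow d (Matrix.diagonal D) * X := by
  ext I J
  rw [tensorPow_diagonal, Matrix.mul_diagonal, Matrix.diagonal_mul]
  by_cases h : X I J = 0
  · simp [h]
  · rw [prod_comp_eq_of_mem_unitaryCommutant hX h, mul_comm]

open scoped ComplexOrder in
/-- Singular value decomposition of an invertible matrix. -/
lemma exists_unitary_mul_diagonal_mul_unitary (G : Matrix (Fin N) (Fin N) ℂ) (hG : IsUnit G) :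
    ∃ W ∈ Matrix.unitaryGroup (Fin N) ℂ, ∃ V ∈ Matrix.unitaryGroup (Fin N) ℂ,
      ∃ D : Fin N → ℂ, G = W * Matrix.diagonal D * V := by
  have hpd : (G.conjTranspose * G).PosDef :=
    Matrix.PosDef.conjTranspose_mul_self G (Matrix.mulVec_injective_of_isUnit hG)
  set V := hpd.1.eigenvectorUnitary with hV
  set l := hpd.1.eigenvalues with hl
  have hlpos : ∀ i, 0 < l i := hpd.eigenvalues_pos
  have hs : ∀ i, (Real.sqrt (l i) : ℂ) ≠ 0 := fun i => by
    exact_mod_cast (Real.sqrt_pos.2 (hlpos i)).ne'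
  have hdiag : star (V : Matrix (Fin N) (Fin N) ℂ) * (star G * G) * V
      = Matrix.diagonal fun i => (l i : ℂ) := by
    have := hpd.1.conjStarAlgAut_star_eigenvectorUnitary
    rw [Unitary.conjStarAlgAut_star_apply] at this
    exact this
  have hVV : (V : Matrix (Fin N) (Fin N) ℂ) * star (V : Matrix (Fin N) (Fin N) ℂ) = 1 :=
    Unitary.coe_mul_star_self V
  set D : Fin N → ℂ := fun i => (Real.sqrt (l i) : ℂ)
  set E : Fin N → ℂ := fun i => (Real.sqrt (l i) : ℂ)⁻¹
  have hstarE : star (Matrix.diagonal E) = Matrix.diagonal E := by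
    rw [Matrix.star_eq_conjTranspose, Matrix.diagonal_conjTranspose]
    congr 1; ext i; simp [E]
  have hED : Matrix.diagonal E * Matrix.diagonal D = 1 := by
    rw [Matrix.diagonal_mul_diagonal, ← Matrix.diagonal_one]
    congr 1; ext i; exact inv_mul_cancel₀ (hs i)
  -- With `D` the singular values and `E` their inverses, `V* G* G V = D²` makes `G V E` unitary.
  refine ⟨G * V * Matrix.diagonal E, ?_, star (V : Matrix (Fin N) (Fin N) ℂ),
    Unitary.star_mem V.2, D, ?_⟩
  · rw [Matrix.mem_unitaryGroup_iff', star_mul, star_mul, hstarE]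
    calc Matrix.diagonal E * (star (V : Matrix (Fin N) (Fin N) ℂ) * star G)
            * (G * V * Matrix.diagonal E)
        = Matrix.diagonal E * (star (V : Matrix (Fin N) (Fin N) ℂ) * (star G * G) * V)
            * Matrix.diagonal E := by simp only [mul_assoc]
      _ = 1 := by
        rw [hdiag, Matrix.diagonal_mul_diagonal, Matrix.diagonal_mul_diagonal,
          ← Matrix.diagonal_one]
        congr 1; ext i
        have h1 : (l i : ℂ) = (Real.sqrt (l i) : ℂ) * (Real.sqrt (l i) : ℂ) := by
          exact_mod_cast (Real.mul_self_sqrt (hlpos i).le).symm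
        simp only [E]
        rw [h1]
        field_simp [hs i]
  · rw [mul_assoc (G * _), hED, mul_one, mul_assoc, hVV, mul_one]

lemma mul_tensorPow_comm_of_isUnit {X : Matrix (Fin d → Fin N) (Fin d → Fin N) ℂ}
    (hX : X ∈ unitaryCommutant N d) {G : Matrix (Fin N) (Fin N) ℂ} (hG : IsUnit G) :
    X * tensorPow d G = tensorPow d G * X := by
  obtain ⟨W, hW, V, hV, D, rfl⟩ := exists_unitary_mul_diagonal_mul_unitary G hG
  rw [tensorPow_mul, tensorPow_mul, ← mul_assoc, ← mul_assoc, hX W hW, mul_assoc _ X,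
    mul_tensorPow_diagonal_comm hX, ← mul_assoc, mul_assoc _ X, hX V hV, mul_assoc, mul_assoc,
    mul_assoc]

/-- `G - s` is invertible off the finitely many eigenvalues `s` of `G`, so the invertible case
extends to `s = 0` by continuity. -/
lemma mul_tensorPow_comm {X : Matrix (Fin d → Fin N) (Fin d → Fin N) ℂ}
    (hX : X ∈ unitaryCommutant N d) (G : Matrix (Fin N) (Fin N) ℂ) :
    X * tensorPow d G = tensorPow d G * X := by
  have hfin : {s : ℂ | G.charpoly.IsRoot s}.Finite :=
    Polynomial.finite_setOfPred_isRoot (Matrix.charpoly_monic G).ne_zero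
  have hdense : Dense {s : ℂ | G.charpoly.IsRoot s}ᶜ := hfin.countable.dense_compl ℂ
  have hcont : Continuous fun s : ℂ => Matrix.scalar (Fin N) s - G := by
    simp only [Matrix.scalar_apply]
    fun_prop
  have h := Continuous.ext_on hdense
    (f := fun s : ℂ => X * tensorPow d (-(Matrix.scalar (Fin N) s - G)))
    (g := fun s : ℂ => tensorPow d (-(Matrix.scalar (Fin N) s - G)) * X)
    (by fun_prop) (by fun_prop) (fun s hs => by
      refine mul_tensorPow_comm_of_isUnit hX (IsUnit.neg ?_)
      rw [Matrix.isUnit_iff_isUnit_det, isUnit_iff_ne_zero, ← Matrix.eval_charpoly]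
      exact hs)
  simpa using congrFun h 0

end TensorPower

/-! ### Polarization and the dimension of the commutant. -/

section Polarization

variable {N d : ℕ}

/-- The sum factors over `t`; with `m` the size of the fibre of `p` over `t`, the factor is `1 - 0 ^
m`, which vanishes exactly when `t` is missed by `p`. -/
lemma sum_bool_prod_eq {d : ℕ} (p : Fin d → Fin d) :
    ∑ s : Fin d → Bool, (∏ t, if s t then (1 : ℂ) else -1) * ∏ k, (if s (p k) then (1 : ℂ) else 0)
      = if Function.Bijective p then 1 else 0 := by
  have h1 : ∀ s : Fin d → Bool, (∏ k, (if s (p k) then (1 : ℂ) else 0))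
      = ∏ t, (if s t then (1 : ℂ) else 0) ^ (Finset.univ.filter fun k => p k = t).card := by
    intro s
    rw [← Finset.prod_fiberwise' Finset.univ p fun t => if s t then (1 : ℂ) else 0]
    simp only [Finset.prod_const]
  simp_rw [h1, ← Finset.prod_mul_distrib]
  rw [← Fintype.piFinset_univ]
  refine (Finset.prod_univ_sum (fun _ => Finset.univ) fun t (b : Bool) =>
    (if b then (1 : ℂ) else -1) *
      (if b then (1 : ℂ) else 0) ^ (Finset.univ.filter fun k => p k = t).card).symm.trans ?_
  simp only [← Finite.surjective_iff_bijective]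
  split_ifs with hp
  · refine Finset.prod_eq_one fun t _ => ?_
    obtain ⟨k, hk⟩ := hp t
    have : (Finset.univ.filter fun k => p k = t).card ≠ 0 :=
      Finset.card_ne_zero_of_mem (a := k) (by simpa using hk)
    simp [this]
  · simp only [Function.Surjective, not_forall, not_exists] at hp
    obtain ⟨t, ht⟩ := hp
    refine Finset.prod_eq_zero (Finset.mem_univ t) ?_
    rw [Finset.card_eq_zero.2 (Finset.filter_eq_empty_iff.2 fun k _ => ht k)]
    simp

lemma sum_perm_eq_sum_bijective {d : ℕ} (f : (Fin d → Fin d) → ℂ) :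
    ∑ σ : Equiv.Perm (Fin d), f σ = ∑ p, if Function.Bijective p then f p else 0 := by
  rw [← Finset.sum_filter]
  refine Finset.sum_bij (fun σ _ => σ) (fun σ _ => Finset.mem_filter.2 ⟨Finset.mem_univ _, σ.bijective⟩)
    (fun σ _ τ _ h => Equiv.coe_fn_injective h)
    (fun p hp => ⟨Equiv.ofBijective p (Finset.mem_filter.1 hp).2, Finset.mem_univ _, rfl⟩)
    (fun _ _ => rfl)

/-- Polarization: the permanent of `M` as an alternating sum of products of partial row sums. -/
lemma sum_perm_prod_eq {d : ℕ} (M : Fin d → Fin d → ℂ) :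
    ∑ σ : Equiv.Perm (Fin d), ∏ k, M (σ k) k
      = ∑ s : Fin d → Bool, (∏ t, if s t then (1 : ℂ) else -1)
          * ∏ k, ∑ t, (if s t then (1 : ℂ) else 0) * M t k := by
  rw [sum_perm_eq_sum_bijective fun p => ∏ k, M (p k) k]
  simp_rw [Finset.prod_univ_sum, Fintype.piFinset_univ, Finset.mul_sum, Finset.prod_mul_distrib]
  rw [Finset.sum_comm]
  refine Finset.sum_congr rfl fun p _ => ?_
  simp_rw [← mul_assoc, ← Finset.sum_mul, sum_bool_prod_eq]
  simp

/-- The sum over permutations of the elementary tensors of the matrix units `E_{A σ(k), B σ(k)}`. -/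
def symmetrizedUnit (A B : Fin d → Fin N) : Matrix (Fin d → Fin N) (Fin d → Fin N) ℂ :=
  ∑ σ : Equiv.Perm (Fin d), Matrix.single (A ∘ σ) (B ∘ σ) 1

lemma symmetrizedUnit_eq_sum_tensorPow (A B : Fin d → Fin N) :
    symmetrizedUnit A B = ∑ s : Fin d → Bool, (∏ t, if s t then (1 : ℂ) else -1) •
      tensorPow d (∑ t, (if s t then (1 : ℂ) else 0) • Matrix.single (A t) (B t) (1 : ℂ)) := by
  ext I J
  simp only [symmetrizedUnit, Matrix.sum_apply, Matrix.smul_apply, tensorPow_apply, smul_eq_mul]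
  rw [← sum_perm_prod_eq fun t k => Matrix.single (A t) (B t) (1 : ℂ) (I k) (J k)]
  refine Finset.sum_congr rfl fun σ _ => ?_
  simp only [Matrix.single_apply, Finset.prod_ite_zero, Finset.prod_const_one,
    funext_iff, Finset.mem_univ, true_imp_iff, Function.comp_apply, ← forall_and]

lemma mul_symmetrizedUnit_comm {X : Matrix (Fin d → Fin N) (Fin d → Fin N) ℂ}
    (hX : X ∈ unitaryCommutant N d) (A B : Fin d → Fin N) :
    X * symmetrizedUnit A B = symmetrizedUnit A B * X := by
  rw [symmetrizedUnit_eq_sum_tensorPow, Finset.mul_sum, Finset.sum_mul]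
  refine Finset.sum_congr rfl fun s _ => ?_
  rw [Matrix.mul_smul, Matrix.smul_mul, mul_tensorPow_comm hX]

/-- The `(I, J)` entry of `mul_symmetrizedUnit_comm`. -/
lemma sum_perm_entry_eq {X : Matrix (Fin d → Fin N) (Fin d → Fin N) ℂ}
    (hX : X ∈ unitaryCommutant N d) (A B I J : Fin d → Fin N) :
    ∑ σ : Equiv.Perm (Fin d), (if B ∘ σ = J then X I (A ∘ σ) else 0)
      = ∑ σ : Equiv.Perm (Fin d), if A ∘ σ = I then X (B ∘ σ) J else 0 := by
  have h := congrFun (congrFun (mul_symmetrizedUnit_comm hX A B) I) J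
  simp only [symmetrizedUnit, Finset.mul_sum, Finset.sum_mul, Matrix.sum_apply,
    Matrix.mul_apply, Matrix.single_apply] at h
  rw [Finset.sum_comm, Finset.sum_comm (s := Finset.univ (α := Fin d → Fin N))] at h
  refine Eq.trans (Finset.sum_congr rfl fun σ _ => ?_)
    (h.trans (Finset.sum_congr rfl fun σ _ => ?_))
  · rw [Finset.sum_eq_single (A ∘ σ) (by intro b _ hb; simp [Ne.symm hb]) (by simp)]
    simp
  · rw [Finset.sum_eq_single (B ∘ σ) (by intro b _ hb; simp [Ne.symm hb]) (by simp)]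
    simp

/-- The traces of `X` against the permutation operators. -/
def permTrace (N d : ℕ) :
    Matrix (Fin d → Fin N) (Fin d → Fin N) ℂ →ₗ[ℂ] (Equiv.Perm (Fin d) → ℂ) where
  toFun X σ := ∑ B : Fin d → Fin N, X (B ∘ σ) B
  map_add' X Y := by ext σ; simp [Finset.sum_add_distrib]
  map_smul' c X := by ext σ; simp [Finset.mul_sum]

/-- A vector annihilated by the Gram operator of the permutation operators is zero. -/
lemma eq_zero_of_sum_perm_eq_zero (x : (Fin d → Fin N) → ℂ)
    (hx : ∀ A, ∑ σ : Equiv.Perm (Fin d), ∑ B : Fin d → Fin N,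
      (if B ∘ σ = B then x (A ∘ σ) else 0) = 0) : x = 0 := by
  set y : (Fin d → Fin N) → (Fin d → Fin N) → (Fin d → Fin N) → ℂ := fun A B K =>
    ∑ σ : Equiv.Perm (Fin d), if B ∘ σ = K then x (A ∘ σ) else 0 with hy
  -- Expanding the squares gives a sum over pairs `τ, σ`. Substituting `B ∘ τ` for `B` and `τ⁻¹ σ`
  -- for `σ` turns the inner sum into the hypothesis at `A ∘ τ`.
  have hsum : ∑ A, ∑ B, ∑ K, star (y A B K) * y A B K = 0 := by
    have h1 : ∀ A B, ∑ K, star (y A B K) * y A B K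
        = ∑ τ : Equiv.Perm (Fin d), star (x (A ∘ τ)) *
          ∑ σ : Equiv.Perm (Fin d), if B ∘ σ = B ∘ τ then x (A ∘ σ) else 0 := by
      intro A B
      simp only [hy, star_sum, Finset.sum_mul]
      rw [Finset.sum_comm]
      refine Finset.sum_congr rfl fun τ _ => ?_
      rw [Finset.sum_eq_single (B ∘ τ) (by intro b _ hb; simp [Ne.symm hb]) (by simp)]
      simp
    simp_rw [h1]
    have h2 : ∀ A, ∑ B : Fin d → Fin N, ∑ τ : Equiv.Perm (Fin d), star (x (A ∘ τ)) *
          (∑ σ : Equiv.Perm (Fin d), if B ∘ σ = B ∘ τ then x (A ∘ σ) else 0) = 0 := by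
      intro A
      rw [Finset.sum_comm]
      refine Finset.sum_eq_zero fun τ _ => ?_
      rw [← Finset.mul_sum]
      refine mul_eq_zero_of_right _ ?_
      rw [Finset.sum_comm]
      refine Eq.trans ?_ (hx (A ∘ τ))
      refine Fintype.sum_equiv (Equiv.mulLeft τ⁻¹) _ _ fun σ => ?_
      refine Fintype.sum_equiv (Equiv.arrowCongr τ⁻¹ (Equiv.refl _)) _ _ fun B => ?_
      have e1 : (A ∘ τ) ∘ (Equiv.mulLeft τ⁻¹ σ) = A ∘ σ := by
        ext k; simp
      have e2 : (Equiv.arrowCongr τ⁻¹ (Equiv.refl _)) B = B ∘ τ := by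
        ext k; simp [Equiv.arrowCongr]; rfl
      have e3 : (B ∘ τ) ∘ (Equiv.mulLeft τ⁻¹ σ) = B ∘ σ := by
        ext k; simp
      rw [e1, e2, e3]
    exact Finset.sum_eq_zero fun A _ => h2 A
  have hyzero : ∀ A B K, y A B K = 0 := by
    have h3 : ∑ A, ∑ B, ∑ K, ‖y A B K‖ ^ 2 = 0 := by
      have : ((∑ A, ∑ B, ∑ K, ‖y A B K‖ ^ 2 : ℝ) : ℂ) = 0 := by
        rw [← hsum]
        push_cast
        simp_rw [← Complex.conj_mul']
        rfl
      exact_mod_cast this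
    intro A B K
    have h4 := (Fintype.sum_eq_zero_iff_of_nonneg (fun A => by positivity)).1 h3
    have h5 := (Fintype.sum_eq_zero_iff_of_nonneg (fun B => by positivity)).1 (congrFun h4 A)
    have h6 := (Fintype.sum_eq_zero_iff_of_nonneg (fun K => by positivity)).1 (congrFun h5 B)
    simpa using congrFun h6 K
  ext A
  -- On the diagonal only the stabilizer of `A` contributes, so `y A A A` is `x A` times its order,
  -- which is nonzero.
  have hA := hyzero A A A
  simp only [hy] at hA
  have h7 : ∀ σ : Equiv.Perm (Fin d), (if A ∘ σ = A then x (A ∘ σ) else 0)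
      = if A ∘ σ = A then x A else 0 := by
    intro σ
    split_ifs with h
    · rw [h]
    · rfl
  simp_rw [h7] at hA
  rw [← Finset.sum_filter, Finset.sum_const, nsmul_eq_mul] at hA
  refine (mul_eq_zero.1 hA).resolve_left ?_
  have : (Finset.univ.filter fun σ : Equiv.Perm (Fin d) => A ∘ σ = A).card ≠ 0 :=
    Finset.card_ne_zero_of_mem (a := 1) (by simp)
  exact_mod_cast this

/-- Setting `J = B` in `sum_perm_entry_eq` and summing over `B` expresses the Gram operator on the
row `X I` through the permutation traces of `X`. -/
lemma eq_zero_of_permTrace_eq_zero {X : Matrix (Fin d → Fin N) (Fin d → Fin N) ℂ}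
    (hX : X ∈ unitaryCommutant N d) (h : permTrace N d X = 0) : X = 0 := by
  suffices H : ∀ I, X I = 0 from funext H
  intro I
  refine eq_zero_of_sum_perm_eq_zero (X I) fun A => ?_
  rw [Finset.sum_comm]
  simp_rw [sum_perm_entry_eq hX A _ I]
  rw [Finset.sum_comm]
  refine Finset.sum_eq_zero fun σ _ => ?_
  split_ifs
  · exact congrFun h σ
  · simp

lemma finrank_unitaryCommutant_le (N d : ℕ) :
    Module.finrank ℂ (unitaryCommutant N d) ≤ d.factorial := by
  have hinj : Function.Injective ((permTrace N d).domRestrict (unitaryCommutant N d)) := by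
    rw [injective_iff_map_eq_zero]
    intro X hX
    exact Subtype.ext (eq_zero_of_permTrace_eq_zero X.2 hX)
  have := LinearMap.finrank_le_finrank_of_injective hinj
  rwa [Module.finrank_fintype_fun_eq_card, Fintype.card_perm, Fintype.card_fin] at this

end Polarization

/-! ### Moments of the trace of a Haar unitary. -/

section Moments

variable {N d : ℕ}

instance : (haarU N).IsMulLeftInvariant := by unfold haarU; infer_instance

lemma integrable_haarU {E : Type*} [NormedAddCommGroup E] [SecondCountableTopology E]
    {f : Matrix.unitaryGroup (Fin N) ℂ → E}
    (hf : Continuous f) : Integrable f (haarU N) := by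
  borelize E
  exact hf.integrable_of_hasCompactSupport (HasCompactSupport.of_compactSpace f)

/-- The average of `X` over conjugation by `U ⊗ ⋯ ⊗ U`. -/
def unitaryAverage (N d : ℕ) :
    Matrix (Fin d → Fin N) (Fin d → Fin N) ℂ →ₗ[ℂ] Matrix (Fin d → Fin N) (Fin d → Fin N) ℂ where
  toFun X := Matrix.of fun I J => ∫ U : Matrix.unitaryGroup (Fin N) ℂ,
    (tensorPow d (U : Matrix (Fin N) (Fin N) ℂ) * X
      * star (tensorPow d (U : Matrix (Fin N) (Fin N) ℂ))) I J ∂(haarU N)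
  map_add' X Y := by
    ext I J
    simp only [Matrix.of_apply, Matrix.add_apply, mul_add, add_mul]
    exact integral_add (integrable_haarU (by fun_prop)) (integrable_haarU (by fun_prop))
  map_smul' c X := by
    ext I J
    simp only [Matrix.of_apply, Matrix.smul_apply, Matrix.mul_smul, Matrix.smul_mul,
      RingHom.id_apply]
    exact integral_smul c _

lemma unitaryAverage_apply (X : Matrix (Fin d → Fin N) (Fin d → Fin N) ℂ)
    (I J : Fin d → Fin N) : unitaryAverage N d X I J = ∫ U : Matrix.unitaryGroup (Fin N) ℂ,
    (tensorPow d (U : Matrix (Fin N) (Fin N) ℂ) * X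
      * star (tensorPow d (U : Matrix (Fin N) (Fin N) ℂ))) I J ∂(haarU N) := rfl

lemma tensorPow_mul_star_self {U : Matrix (Fin N) (Fin N) ℂ}
    (hU : U ∈ Matrix.unitaryGroup (Fin N) ℂ) : tensorPow d U * star (tensorPow d U) = 1 := by
  rw [← tensorPow_star, ← tensorPow_mul, Matrix.mem_unitaryGroup_iff.1 hU, tensorPow_one]

lemma star_tensorPow_mul_self {U : Matrix (Fin N) (Fin N) ℂ}
    (hU : U ∈ Matrix.unitaryGroup (Fin N) ℂ) : star (tensorPow d U) * tensorPow d U = 1 := by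
  rw [← tensorPow_star, ← tensorPow_mul, Matrix.mem_unitaryGroup_iff'.1 hU, tensorPow_one]

lemma conj_unitaryAverage (X : Matrix (Fin d → Fin N) (Fin d → Fin N) ℂ)
    (V : Matrix.unitaryGroup (Fin N) ℂ) :
    tensorPow d (V : Matrix (Fin N) (Fin N) ℂ) * unitaryAverage N d X
      * star (tensorPow d (V : Matrix (Fin N) (Fin N) ℂ)) = unitaryAverage N d X := by
  ext I J
  rw [unitaryAverage_apply, ← integral_mul_left_eq_self _ V]
  have h : ∀ U : Matrix.unitaryGroup (Fin N) ℂ,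
      (tensorPow d ((V * U : Matrix.unitaryGroup (Fin N) ℂ) : Matrix (Fin N) (Fin N) ℂ) * X
        * star (tensorPow d ((V * U : Matrix.unitaryGroup (Fin N) ℂ) : Matrix (Fin N) (Fin N) ℂ))) I J
      = ∑ L, (∑ K, tensorPow d (V : Matrix (Fin N) (Fin N) ℂ) I K *
        (tensorPow d (U : Matrix (Fin N) (Fin N) ℂ) * X
          * star (tensorPow d (U : Matrix (Fin N) (Fin N) ℂ))) K L)
        * star (tensorPow d (V : Matrix (Fin N) (Fin N) ℂ)) L J := by
    intro U
    simp_rw [← Matrix.mul_apply]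
    rw [Submonoid.coe_mul, tensorPow_mul, star_mul]
    simp only [mul_assoc]
  simp_rw [h]
  rw [Matrix.mul_apply, integral_finsetSum _ fun L _ => integrable_haarU (by fun_prop)]
  refine Finset.sum_congr rfl fun L _ => ?_
  rw [integral_mul_const, Matrix.mul_apply,
    integral_finsetSum _ fun K _ => integrable_haarU (by fun_prop)]
  congr 1
  refine Finset.sum_congr rfl fun K _ => ?_
  rw [integral_const_mul, unitaryAverage_apply]

lemma isProj_unitaryAverage :
    LinearMap.IsProj (unitaryCommutant N d) (unitaryAverage N d) where
  map_mem X U hU := by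
    have h := conj_unitaryAverage X ⟨U, hU⟩
    simp only at h
    conv_lhs => rw [← h]
    rw [mul_assoc, star_tensorPow_mul_self hU, mul_one]
  map_id X hX := by
    ext I J
    have h : ∀ U : Matrix.unitaryGroup (Fin N) ℂ, (tensorPow d (U : Matrix (Fin N) (Fin N) ℂ) * X
        * star (tensorPow d (U : Matrix (Fin N) (Fin N) ℂ))) = X := by
      intro U
      rw [← hX _ U.2, mul_assoc, tensorPow_mul_star_self U.2, mul_one]
    rw [unitaryAverage_apply]
    simp [h]

/-- In the basis of matrix units, conjugation by `T = U ⊗ ⋯ ⊗ U` has diagonal entries `T I I * star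
(T J J)`, whose sum is `|Tr T|² = |Tr U| ^ (2 d)`. -/
lemma trace_unitaryAverage : LinearMap.trace ℂ _ (unitaryAverage N d)
    = ∫ U : Matrix.unitaryGroup (Fin N) ℂ,
      ((‖Matrix.trace (U : Matrix (Fin N) (Fin N) ℂ)‖ ^ (2 * d) : ℝ) : ℂ) ∂(haarU N) := by
  rw [LinearMap.trace_eq_matrix_trace ℂ (Matrix.stdBasis ℂ _ _), Matrix.trace]
  have h : ∀ p : (Fin d → Fin N) × (Fin d → Fin N),
      (LinearMap.toMatrix (Matrix.stdBasis ℂ _ _) (Matrix.stdBasis ℂ _ _)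
        (unitaryAverage N d)).diag p = ∫ U : Matrix.unitaryGroup (Fin N) ℂ,
        tensorPow d (U : Matrix (Fin N) (Fin N) ℂ) p.1 p.1 *
          star (tensorPow d (U : Matrix (Fin N) (Fin N) ℂ) p.2 p.2) ∂(haarU N) := by
    rintro ⟨I, J⟩
    rw [Matrix.diag_apply, LinearMap.toMatrix_apply, Matrix.stdBasis_eq_single]
    have h2 : ∀ Y : Matrix (Fin d → Fin N) (Fin d → Fin N) ℂ,
        (Matrix.stdBasis ℂ (Fin d → Fin N) (Fin d → Fin N)).repr Y (I, J) = Y I J := fun Y => by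
      simp [Matrix.stdBasis]
    rw [h2, unitaryAverage_apply]
    refine integral_congr_ae (.of_forall fun U => ?_)
    simp only [Matrix.mul_apply, Matrix.star_apply]
    rw [Finset.sum_eq_single J (by intro b _ hb; simp [Ne.symm hb])
      (by simp), Finset.sum_eq_single I (by intro b _ hb; simp [Ne.symm hb])
      (by simp)]
    simp
  simp_rw [h]
  rw [← integral_finsetSum _ fun p _ => integrable_haarU (by fun_prop)]
  refine integral_congr_ae (.of_forall fun U => ?_)
  simp only
  rw [Fintype.sum_prod_type]
  simp_rw [← Finset.mul_sum, ← Finset.sum_mul, ← star_sum]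
  have h3 : ∑ I, tensorPow d (U : Matrix (Fin N) (Fin N) ℂ) I I
      = Matrix.trace (U : Matrix (Fin N) (Fin N) ℂ) ^ d := trace_tensorPow _
  rw [h3, pow_mul, ← Complex.normSq_eq_norm_sq]
  push_cast
  rw [← Complex.mul_conj, mul_pow, star_pow]
  rfl

/-- The trace of a projection is the dimension of its image, here the commutant. -/
lemma integral_norm_trace_pow_le (N d : ℕ) :
    ∫ U : Matrix.unitaryGroup (Fin N) ℂ,
      ‖Matrix.trace (U : Matrix (Fin N) (Fin N) ℂ)‖ ^ (2 * d) ∂(haarU N) ≤ d.factorial := by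
  have h := isProj_unitaryAverage (N := N) (d := d).trace
  rw [trace_unitaryAverage, integral_complex_ofReal] at h
  have h2 : ∫ U : Matrix.unitaryGroup (Fin N) ℂ,
      ‖Matrix.trace (U : Matrix (Fin N) (Fin N) ℂ)‖ ^ (2 * d) ∂(haarU N)
      = Module.finrank ℂ (unitaryCommutant N d) := by exact_mod_cast h
  rw [h2]
  exact_mod_cast finrank_unitaryCommutant_le N d

/-- Writing `a = cos φ * e ^ (i θ)` exhibits it as the midpoint of `e ^ (i (θ + φ))` and `e ^ (i (θ
- φ))`. -/
lemma exists_eq_half_add_of_norm_le_one {a : ℂ} (ha : ‖a‖ ≤ 1) :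
    ∃ p : ℂ × ℂ, ‖p.1‖ = 1 ∧ ‖p.2‖ = 1 ∧ a = (p.1 + p.2) / 2 := by
  set φ := Real.arccos ‖a‖
  have hφ : Real.cos φ = ‖a‖ := Real.cos_arccos (by linarith [norm_nonneg a]) ha
  refine ⟨(Complex.exp ((a.arg + φ : ℝ) * Complex.I), Complex.exp ((a.arg - φ : ℝ) * Complex.I)),
    Complex.norm_exp_ofReal_mul_I _, Complex.norm_exp_ofReal_mul_I _, ?_⟩
  have hc : (‖a‖ : ℂ) = Complex.cos φ := by rw [← hφ]; push_cast; rfl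
  conv_lhs => rw [← Complex.norm_mul_exp_arg_mul_I a, hc, Complex.cos]
  push_cast
  simp only [add_mul, sub_mul, Complex.exp_add, Complex.exp_sub, neg_mul, Complex.exp_neg]
  ring

/-- A unimodular diagonal factor is absorbed by Haar invariance. A general `a` is the midpoint of
two unimodular vectors, and the trace is linear in `a`, so convexity of `x ^ (2 d)` finishes. -/
lemma integral_norm_trace_diagonal_mul_pow_le (d : ℕ) {a : Fin N → ℂ} (ha : ∀ i, ‖a i‖ ≤ 1) :
    ∫ U : Matrix.unitaryGroup (Fin N) ℂ,
      ‖Matrix.trace (Matrix.diagonal a * (U : Matrix (Fin N) (Fin N) ℂ))‖ ^ (2 * d) ∂(haarU N)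
      ≤ d.factorial := by
  choose p hp1 hp2 hp using fun i => exists_eq_half_add_of_norm_le_one (ha i)
  have hunit : ∀ D : Fin N → ℂ, (∀ i, ‖D i‖ = 1) → ∫ U : Matrix.unitaryGroup (Fin N) ℂ,
      ‖Matrix.trace (Matrix.diagonal D * (U : Matrix (Fin N) (Fin N) ℂ))‖ ^ (2 * d) ∂(haarU N)
      ≤ d.factorial := by
    intro D hD
    refine le_trans (le_of_eq ?_) (integral_norm_trace_pow_le N d)
    exact integral_mul_left_eq_self (μ := haarU N) (fun U : Matrix.unitaryGroup (Fin N) ℂ =>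
      ‖Matrix.trace (U : Matrix (Fin N) (Fin N) ℂ)‖ ^ (2 * d))
      ⟨_, diagonal_mem_unitaryGroup hD⟩
  have hpt : ∀ U : Matrix.unitaryGroup (Fin N) ℂ,
      ‖Matrix.trace (Matrix.diagonal a * (U : Matrix (Fin N) (Fin N) ℂ))‖ ^ (2 * d)
      ≤ (1 / 2 : ℝ) *
          ‖Matrix.trace (Matrix.diagonal (fun i => (p i).1) * (U : Matrix (Fin N) (Fin N) ℂ))‖ ^ (2 * d)
        + (1 / 2 : ℝ) *
          ‖Matrix.trace (Matrix.diagonal (fun i => (p i).2) * (U : Matrix (Fin N) (Fin N) ℂ))‖ ^ (2 * d) := by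
    intro U
    have htr : Matrix.trace (Matrix.diagonal a * (U : Matrix (Fin N) (Fin N) ℂ))
        = (1 / 2 : ℂ) * Matrix.trace (Matrix.diagonal (fun i => (p i).1) * (U : Matrix (Fin N) (Fin N) ℂ))
          + (1 / 2 : ℂ) * Matrix.trace (Matrix.diagonal (fun i => (p i).2) * (U : Matrix (Fin N) (Fin N) ℂ)) := by
      simp only [Matrix.trace, Matrix.diag_apply, Matrix.diagonal_mul, Finset.mul_sum,
        ← Finset.sum_add_distrib]
      refine Finset.sum_congr rfl fun i _ => ?_
      rw [hp i]; ring
    have hle : ‖Matrix.trace (Matrix.diagonal a * (U : Matrix (Fin N) (Fin N) ℂ))‖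
        ≤ (1 / 2 : ℝ) * ‖Matrix.trace (Matrix.diagonal (fun i => (p i).1) * (U : Matrix (Fin N) (Fin N) ℂ))‖
        + (1 / 2 : ℝ) *
          ‖Matrix.trace (Matrix.diagonal (fun i => (p i).2) * (U : Matrix (Fin N) (Fin N) ℂ))‖ := by
      rw [htr]
      refine (norm_add_le _ _).trans (le_of_eq ?_)
      simp
    refine (pow_le_pow_left₀ (norm_nonneg _) hle _).trans ?_
    exact (convexOn_pow (2 * d)).2 (norm_nonneg _) (norm_nonneg _) (by norm_num) (by norm_num)
      (by norm_num)
  refine (integral_mono (integrable_haarU (by fun_prop)) (integrable_haarU (by fun_prop))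
    hpt).trans ?_
  rw [integral_add (integrable_haarU (by fun_prop)) (integrable_haarU (by fun_prop)),
    integral_const_mul, integral_const_mul]
  linarith [hunit _ hp1, hunit _ hp2]

end Moments

/-! ### Coefficient bounds for the HCIZ and BGW integrals. -/

section Integrals

variable {N : ℕ}

lemma hasSum_integral_exp_mul {T : Matrix.unitaryGroup (Fin N) ℂ → ℂ} (hT : Continuous T) (w : ℂ) :
    HasSum (fun n : ℕ => (∫ U, T U ^ n ∂(haarU N)) / n.factorial * w ^ n)
      (∫ U, Complex.exp (w * T U) ∂(haarU N)) := by
  obtain ⟨C, hC⟩ := (isCompact_range hT).isBounded.exists_norm_le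
  have hC' : ∀ U, ‖T U‖ ≤ C := fun U => hC _ ⟨U, rfl⟩
  have h := hasSum_integral_of_dominated_convergence (μ := haarU N)
    (F := fun (n : ℕ) U => T U ^ n / n.factorial * w ^ n)
    (f := fun U => Complex.exp (w * T U))
    (fun n _ => (C * ‖w‖) ^ n / n.factorial)
    (fun n => (integrable_haarU (by fun_prop)).aestronglyMeasurable)
    (fun n => .of_forall fun U => by
      rw [norm_mul, norm_div, norm_pow, norm_pow, mul_pow, div_mul_eq_mul_div,
        Complex.norm_natCast]
      gcongr
      exact hC' U)
    (.of_forall fun U => Real.summable_pow_div_factorial _)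
    (integrable_const _)
    (.of_forall fun U => by
      have h2 := NormedSpace.expSeries_div_hasSum_exp (𝔸 := ℂ) (w * T U)
      rw [← Complex.exp_eq_exp_ℂ] at h2
      refine h2.congr_fun fun n => ?_
      rw [mul_pow]; ring)
  simpa only [integral_mul_const, integral_div] using h

lemma coe_inv_eq_star (U : Matrix.unitaryGroup (Fin N) ℂ) :
    ((U⁻¹ : Matrix.unitaryGroup (Fin N) ℂ) : Matrix (Fin N) (Fin N) ℂ)
      = star (U : Matrix (Fin N) (Fin N) ℂ) := rfl

lemma sum_norm_sq_row (U : Matrix.unitaryGroup (Fin N) ℂ) (i : Fin N) :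
    ∑ j, ‖(U : Matrix (Fin N) (Fin N) ℂ) i j‖ ^ 2 = 1 := by
  have h := congrFun (congrFun (Matrix.mem_unitaryGroup_iff.1 U.2) i) i
  rw [Matrix.mul_apply, Matrix.one_apply_eq] at h
  have h2 : ((∑ j, ‖(U : Matrix (Fin N) (Fin N) ℂ) i j‖ ^ 2 : ℝ) : ℂ) = 1 := by
    rw [← h]
    push_cast
    refine Finset.sum_congr rfl fun j _ => ?_
    rw [← Complex.mul_conj']
    rfl
  exact_mod_cast h2

/-- The trace is the sum of `a i * b j * |U i j|²`, and each row of `U` has unit length. -/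
lemma norm_trace_diagonal_conj_le {a b : Fin N → ℂ} (ha : ∀ i, ‖a i‖ ≤ 1) (hb : ∀ i, ‖b i‖ ≤ 1)
    (U : Matrix.unitaryGroup (Fin N) ℂ) :
    ‖Matrix.trace (Matrix.diagonal a * (U : Matrix (Fin N) (Fin N) ℂ) * Matrix.diagonal b
        * ((U⁻¹ : Matrix.unitaryGroup (Fin N) ℂ) : Matrix (Fin N) (Fin N) ℂ))‖ ≤ N := by
  rw [Matrix.trace]
  calc _ ≤ ∑ i : Fin N, (1 : ℝ) := ?_
    _ = N := by simp
  refine norm_sum_le_of_le _ fun i _ => ?_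
  rw [Matrix.diag_apply, Matrix.mul_apply, ← sum_norm_sq_row U i]
  refine norm_sum_le_of_le _ fun j _ => ?_
  rw [Matrix.mul_diagonal, Matrix.diagonal_mul, coe_inv_eq_star, Matrix.star_apply, norm_mul,
    norm_mul, norm_mul, norm_star]
  calc ‖a i‖ * ‖(U : Matrix (Fin N) (Fin N) ℂ) i j‖ * ‖b j‖ * ‖(U : Matrix (Fin N) (Fin N) ℂ) i j‖
      ≤ 1 * ‖(U : Matrix (Fin N) (Fin N) ℂ) i j‖ * 1 * ‖(U : Matrix (Fin N) (Fin N) ℂ) i j‖ := by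
        gcongr
        · exact ha i
        · exact hb j
    _ = _ := by ring

@[fun_prop]
lemma continuous_coe_inv : Continuous fun U : Matrix.unitaryGroup (Fin N) ℂ =>
    ((U⁻¹ : Matrix.unitaryGroup (Fin N) ℂ) : Matrix (Fin N) (Fin N) ℂ) :=
  continuous_subtype_val.comp continuous_inv

theorem polydiscNorm_hciz_lt {t ρ : ℝ} (ht : 0 < t) (hρ : 0 < ρ) (hρt : ρ < t / Real.exp 1)
    (N : ℕ) :
    polydiscNorm ρ (fun z x => hciz N z x
        - couplingTruncation (hciz N) ⌊t * (N : ℝ) ^ 2⌋₊ z x)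
      < ENNReal.ofReal (u t ρ * Real.exp (-v t ρ * (N : ℝ) ^ 2)) := by
  set T : (Fin N ⊕ Fin N → ℂ) → Matrix.unitaryGroup (Fin N) ℂ → ℂ := fun x U =>
    Matrix.trace (Matrix.diagonal (fun i => x (Sum.inl i)) * (U : Matrix (Fin N) (Fin N) ℂ)
      * Matrix.diagonal (fun i => x (Sum.inr i))
      * ((U⁻¹ : Matrix.unitaryGroup (Fin N) ℂ) : Matrix (Fin N) (Fin N) ℂ)) with hT
  refine polydiscNorm_sub_couplingTruncation_lt (hciz N)
    (fun d x => (∫ U, T x U ^ d ∂(haarU N)) / d.factorial * (N : ℂ) ^ d) N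
    (fun x z => ?_) (fun x => by simp) (fun d x hx => ?_) ht hρ hρt
  · have h := hasSum_integral_exp_mul (T := T x) (by fun_prop) (z * N)
    refine h.congr_fun fun d => ?_
    rw [mul_pow]; ring
  -- One `N ^ d` comes from the trace, the other from the factor `N` in the exponent.
  · have h1 : ‖∫ U, T x U ^ d ∂(haarU N)‖ ≤ (N : ℝ) ^ d := by
      refine (norm_integral_le_of_norm_le_const (C := (N : ℝ) ^ d)
        (.of_forall fun U => ?_)).trans (by simp)
      rw [norm_pow]
      exact pow_le_pow_left₀ (norm_nonneg _)
        (norm_trace_diagonal_conj_le (fun i => hx _) (fun i => hx _) U) d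
    rw [norm_mul, norm_div, Complex.norm_natCast, norm_pow, Complex.norm_natCast, two_mul, pow_add,
      div_mul_eq_mul_div]
    gcongr

/-- Translating by the scalar unitary `e ^ i` multiplies the integral by `e ^ (i (j - k)) ≠ 1`. -/
lemma integral_trace_pow_mul_trace_pow_eq_zero (A : Matrix (Fin N) (Fin N) ℂ) {j k : ℕ}
    (hjk : j ≠ k) :
    ∫ U : Matrix.unitaryGroup (Fin N) ℂ, Matrix.trace (A * (U : Matrix (Fin N) (Fin N) ℂ)) ^ j *
      Matrix.trace ((U⁻¹ : Matrix.unitaryGroup (Fin N) ℂ) : Matrix (Fin N) (Fin N) ℂ) ^ k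
        ∂(haarU N) = 0 := by
  set ω := Complex.exp Complex.I with hω
  have hnorm : ‖ω‖ = 1 := by simpa using Complex.norm_exp_ofReal_mul_I 1
  have hconj : ω * star ω = 1 := by
    rw [← starRingEnd_apply, Complex.mul_conj, Complex.normSq_eq_norm_sq, hnorm]; simp
  set V : Matrix.unitaryGroup (Fin N) ℂ := ⟨ω • 1, by
    rw [Matrix.mem_unitaryGroup_iff, star_smul, smul_mul_smul_comm, hconj]; simp⟩ with hV
  set f : Matrix.unitaryGroup (Fin N) ℂ → ℂ := fun U =>
    Matrix.trace (A * (U : Matrix (Fin N) (Fin N) ℂ)) ^ j *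
      Matrix.trace ((U⁻¹ : Matrix.unitaryGroup (Fin N) ℂ) : Matrix (Fin N) (Fin N) ℂ) ^ k with hf
  have h1 : ∀ U, f (V * U) = (ω ^ j * star ω ^ k) * f U := by
    intro U
    have e : ((V * U : Matrix.unitaryGroup (Fin N) ℂ) : Matrix (Fin N) (Fin N) ℂ)
        = ω • (U : Matrix (Fin N) (Fin N) ℂ) := by
      rw [Submonoid.coe_mul]; simp [hV]
    simp only [hf, coe_inv_eq_star, e, star_smul, Matrix.mul_smul, Matrix.trace_smul, smul_eq_mul,
      mul_pow]
    ring
  have h2 := integral_mul_left_eq_self (μ := haarU N) f V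
  simp_rw [h1] at h2
  rw [integral_const_mul] at h2
  by_contra hne
  have h3 : ω ^ j * star ω ^ k = 1 := mul_right_cancel₀ hne (by rw [h2, one_mul])
  refine hjk (exp_I_pow_injective ?_)
  calc ω ^ j = ω ^ j * (ω * star ω) ^ k := by rw [hconj]; simp
    _ = (ω ^ j * star ω ^ k) * ω ^ k := by rw [mul_pow]; ring
    _ = ω ^ k := by rw [h3, one_mul]

/-- By `x y ≤ (x² + y²) / 2` the mixed moment is controlled by two absolute moments, each at most
`d!`. -/
lemma norm_integral_trace_pow_mul_trace_pow_le {a : Fin N → ℂ} (ha : ∀ i, ‖a i‖ ≤ 1) (d : ℕ) :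
    ‖∫ U : Matrix.unitaryGroup (Fin N) ℂ,
      Matrix.trace (Matrix.diagonal a * (U : Matrix (Fin N) (Fin N) ℂ)) ^ d *
      Matrix.trace ((U⁻¹ : Matrix.unitaryGroup (Fin N) ℂ) : Matrix (Fin N) (Fin N) ℂ) ^ d
        ∂(haarU N)‖ ≤ d.factorial := by
  have hpt : ∀ U : Matrix.unitaryGroup (Fin N) ℂ,
      ‖Matrix.trace (Matrix.diagonal a * (U : Matrix (Fin N) (Fin N) ℂ)) ^ d *
        Matrix.trace ((U⁻¹ : Matrix.unitaryGroup (Fin N) ℂ) : Matrix (Fin N) (Fin N) ℂ) ^ d‖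
      ≤ (1 / 2 : ℝ) *
          ‖Matrix.trace (Matrix.diagonal a * (U : Matrix (Fin N) (Fin N) ℂ))‖ ^ (2 * d)
        + (1 / 2 : ℝ) * ‖Matrix.trace (U : Matrix (Fin N) (Fin N) ℂ)‖ ^ (2 * d) := by
    intro U
    rw [coe_inv_eq_star, Matrix.star_eq_conjTranspose, Matrix.trace_conjTranspose, norm_mul,
      norm_pow, norm_pow, norm_star, mul_comm 2 d, pow_mul, pow_mul]
    nlinarith [sq_nonneg (‖Matrix.trace (Matrix.diagonal a * (U : Matrix (Fin N) (Fin N) ℂ))‖ ^ d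
      - ‖Matrix.trace (U : Matrix (Fin N) (Fin N) ℂ)‖ ^ d)]
  refine (norm_integral_le_integral_norm _).trans
    ((integral_mono (integrable_haarU (by fun_prop)) (integrable_haarU (by fun_prop)) hpt).trans ?_)
  rw [integral_add (integrable_haarU (by fun_prop)) (integrable_haarU (by fun_prop)),
    integral_const_mul, integral_const_mul]
  linarith [integral_norm_trace_diagonal_mul_pow_le d ha, integral_norm_trace_pow_le N d]

lemma integral_trace_add_trace_pow (A : Matrix (Fin N) (Fin N) ℂ) (n : ℕ) :
    ∫ U : Matrix.unitaryGroup (Fin N) ℂ, Matrix.trace (A * (U : Matrix (Fin N) (Fin N) ℂ)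
      + 1 * ((U⁻¹ : Matrix.unitaryGroup (Fin N) ℂ) : Matrix (Fin N) (Fin N) ℂ)) ^ n ∂(haarU N)
    = ∑ m ∈ Finset.range (n + 1), (∫ U : Matrix.unitaryGroup (Fin N) ℂ,
        Matrix.trace (A * (U : Matrix (Fin N) (Fin N) ℂ)) ^ m *
        Matrix.trace ((U⁻¹ : Matrix.unitaryGroup (Fin N) ℂ) : Matrix (Fin N) (Fin N) ℂ) ^ (n - m)
          ∂(haarU N)) * n.choose m := by
  simp_rw [one_mul, Matrix.trace_add, add_pow]
  rw [integral_finsetSum _ fun m _ => integrable_haarU (by fun_prop)]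
  simp_rw [integral_mul_const]

lemma integral_trace_add_trace_pow_odd (A : Matrix (Fin N) (Fin N) ℂ) {n : ℕ} (hn : ¬ Even n) :
    ∫ U : Matrix.unitaryGroup (Fin N) ℂ, Matrix.trace (A * (U : Matrix (Fin N) (Fin N) ℂ)
      + 1 * ((U⁻¹ : Matrix.unitaryGroup (Fin N) ℂ) : Matrix (Fin N) (Fin N) ℂ)) ^ n ∂(haarU N)
    = 0 := by
  rw [integral_trace_add_trace_pow]
  refine Finset.sum_eq_zero fun m hm => ?_
  rw [Finset.mem_range] at hm
  rw [integral_trace_pow_mul_trace_pow_eq_zero A fun h => hn ⟨m, by omega⟩, zero_mul]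

lemma integral_trace_add_trace_pow_even (A : Matrix (Fin N) (Fin N) ℂ) (d : ℕ) :
    ∫ U : Matrix.unitaryGroup (Fin N) ℂ, Matrix.trace (A * (U : Matrix (Fin N) (Fin N) ℂ)
      + 1 * ((U⁻¹ : Matrix.unitaryGroup (Fin N) ℂ) : Matrix (Fin N) (Fin N) ℂ)) ^ (2 * d) ∂(haarU N)
    = (∫ U : Matrix.unitaryGroup (Fin N) ℂ,
        Matrix.trace (A * (U : Matrix (Fin N) (Fin N) ℂ)) ^ d *
        Matrix.trace ((U⁻¹ : Matrix.unitaryGroup (Fin N) ℂ) : Matrix (Fin N) (Fin N) ℂ) ^ d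
          ∂(haarU N)) * (2 * d).choose d := by
  rw [integral_trace_add_trace_pow, Finset.sum_eq_single d]
  · rw [two_mul, Nat.add_sub_cancel]
  · intro m hm hmd
    rw [Finset.mem_range] at hm
    rw [integral_trace_pow_mul_trace_pow_eq_zero A (by omega), zero_mul]
  · intro h
    exact absurd (Finset.mem_range.2 (by omega)) h

theorem polydiscNorm_bgw_lt {t ρ : ℝ} (ht : 0 < t) (hρ : 0 < ρ) (hρt : ρ < t / Real.exp 1)
    (N : ℕ) :
    polydiscNorm ρ (fun z a => bgw N z a
        - couplingTruncation (bgw N) ⌊t * (N : ℝ) ^ 2⌋₊ z a)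
      < ENNReal.ofReal (u t ρ * Real.exp (-v t ρ * (N : ℝ) ^ 2)) := by
  set T : (Fin N → ℂ) → Matrix.unitaryGroup (Fin N) ℂ → ℂ := fun a U =>
    Matrix.trace (Matrix.diagonal a * (U : Matrix (Fin N) (Fin N) ℂ)
      + 1 * ((U⁻¹ : Matrix.unitaryGroup (Fin N) ℂ) : Matrix (Fin N) (Fin N) ℂ)) with hT
  refine polydiscNorm_sub_couplingTruncation_lt (bgw N)
    (fun d a => (∫ U, T a U ^ (2 * d) ∂(haarU N)) / (2 * d).factorial * (N : ℂ) ^ (2 * d)) N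
    (fun a z => ?_) (fun a => by simp) (fun d a ha => ?_) ht hρ hρt
  · have h := hasSum_integral_exp_mul (T := T a) (by fun_prop) (Complex.sqrt z * N)
    have hinj : Function.Injective fun d : ℕ => 2 * d := fun _ _ h => by simpa using h
    -- Odd powers of `√z` have zero coefficient, so reindexing by `n = 2 d` leaves a power series in
    -- `z`.
    have h2 := (hinj.hasSum_iff fun n hn => by
      have hodd : ¬ Even n := fun ⟨m, hm⟩ => hn ⟨m, by simp only; omega⟩
      rw [integral_trace_add_trace_pow_odd _ hodd, zero_div, zero_mul]).2 h
    refine h2.congr_fun fun d => ?_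
    have hsq : Complex.sqrt z ^ 2 = z := by
      rw [Complex.sqrt]
      exact Complex.cpow_nat_inv_pow z two_ne_zero
    rw [Function.comp_apply, mul_pow, pow_mul (Complex.sqrt z), hsq]
    ring
  · rw [norm_mul, norm_div, Complex.norm_natCast, norm_pow, Complex.norm_natCast,
      integral_trace_add_trace_pow_even, norm_mul, Complex.norm_natCast]
    have h1 := norm_integral_trace_pow_mul_trace_pow_le ha d
    have h2 : ((2 * d).choose d : ℝ) * d.factorial * d.factorial = (2 * d).factorial := by
      have := Nat.choose_mul_factorial_mul_factorial (by omega : d ≤ 2 * d)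
      rw [two_mul, Nat.add_sub_cancel, ← two_mul] at this
      exact_mod_cast this
    have hf : (0 : ℝ) < d.factorial := by positivity
    -- The single surviving binomial term gives `d! * (2d choose d) / (2d)! = 1 / d!`.
    calc _ ≤ (d.factorial : ℝ) * (2 * d).choose d / (2 * d).factorial * (N : ℝ) ^ (2 * d) := by
          gcongr
      _ = _ := by
          have hc : ((2 * d).choose d : ℝ) ≠ 0 := by
            exact_mod_cast (Nat.choose_pos (by omega)).ne'
          rw [← h2]
          field_simp

end Integrals

end StrongCoupling

end

theorem mainTheorem8 (t ρ : ℝ) (ht : 0 < t) (hρ : 0 < ρ) (hρt : ρ < t / Real.exp 1)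
    (N : ℕ) (hN : 1 ≤ N) :
    StrongCoupling.polydiscNorm ρ (fun z a => StrongCoupling.bgw N z a
          - StrongCoupling.couplingTruncation (StrongCoupling.bgw N) ⌊t * (N : ℝ) ^ 2⌋₊ z a)
        < ENNReal.ofReal
          (StrongCoupling.u t ρ * Real.exp (-StrongCoupling.v t ρ * (N : ℝ) ^ 2)) ∧
    StrongCoupling.polydiscNorm ρ (fun z x => StrongCoupling.hciz N z x
          - StrongCoupling.couplingTruncation (StrongCoupling.hciz N) ⌊t * (N : ℝ) ^ 2⌋₊ z x)
        < ENNReal.ofReal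
          (StrongCoupling.u t ρ * Real.exp (-StrongCoupling.v t ρ * (N : ℝ) ^ 2)) :=
  ⟨StrongCoupling.polydiscNorm_bgw_lt ht hρ hρt N, StrongCoupling.polydiscNorm_hciz_lt ht hρ hρt N⟩
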